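/- All graphs are finite. For positive integers $n\ge 2d$, let $K_{n/d}$ be the graph on $\{0,\dots,n-1\}$ in which $i,j$ are adjacent iff $d\le |i-j|\le n-d$. The circular chromatic number of a graph $H$ (possibly with loops) is $\chi_c(H)=\inf\{n/d : \text{there is a homomorphism } H\to K_{n/d}\}$, with $\inf\varnothing=+\infty$ (so $\chi_c(H)=+\infty$ if $H$ has a loop). For a simple graph $G$ and a positive integer $m$, let $G^{1/m}$ be the graph obtained from $G$ by replacing each edge with a path with $m$ edges; for a positive integer $k$, let $G^{k/m}$ be the graph on the vertex set of $G^{1/m}$ in which $u$ and $v$ (possibly equal) are joined iff there is a walk of length exactly $k$ from $u$ to $v$ in $G^{1/m}$. Theorem. Let $G$ be a finite simple non-bipartite graph, and let $r,s\ge 0$ be integers. Then $\chi_c(G)<\infty$ and $$\chi_c\bigl(G^{\frac{1}{2s+1}}\bigr)=\frac{(2s+1)\,\chi_c(G)}{s\,\chi_c(G)+1}.$$ Moreover, if $\chi_c\bigl(G^{\frac{2r+1}{2s+1}}\bigr)<4$, then $(s-r)\chi_c(G)+2r+1>0$ and $$\chi_c\bigl(G^{\frac{2r+1}{2s+1}}\bigr)=\frac{(2s+1)\,\chi_c(G)}{(s-r)\,\chi_c(G)+2r+1}.$$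 -/

import Mathlib

/-- Adjacency of the circular complete graph `K_{n/d}` on `{0, …, n - 1}`:
`i` and `j` are adjacent iff `d ≤ |i - j| ≤ n - d` (used for `0 < d`, `2 * d ≤ n`). -/
def circularCompleteAdj (n d : ℕ) (i j : Fin n) : Prop :=
  (d : ℤ) ≤ |(i : ℤ) - (j : ℤ)| ∧ |(i : ℤ) - (j : ℤ)| ≤ (n : ℤ) - (d : ℤ)

/-- The circular chromatic number: the infimum of all `n / d` such that there is a homomorphism
to `K_{n/d}`. The graph is given by its adjacency relation, so that graphs with loops are covered.
The infimum is taken in `EReal`; it is `⊤` when there is no such homomorphism, as for a graph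
with a loop. -/
noncomputable def circularChromaticNumber {V : Type*} (A : V → V → Prop) : EReal :=
  sInf {x : EReal | ∃ n d : ℕ, 0 < d ∧ 2 * d ≤ n ∧ Nonempty (A →r circularCompleteAdj n d) ∧
    x = (((n : ℝ) / (d : ℝ) : ℝ) : EReal)}

namespace SimpleGraph

/-- Vertices of the `m`-subdivision: the old vertices, and `m - 1` inner vertices for each edge. -/
abbrev SubdivVertex {V : Type*} (G : SimpleGraph V) (m : ℕ) : Type _ :=
  V ⊕ (G.edgeSet × Fin (m - 1))

/-- The `i`-th vertex, `0 ≤ i ≤ m`, of the path with `m` edges that replaces the edge `e`.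
The path runs between the two ends of `e`, in a chosen direction, and its inner vertices are
`(e, 0), …, (e, m - 2)`. -/
noncomputable def subdivPath {V : Type*} (G : SimpleGraph V) (m : ℕ) (e : G.edgeSet) (i : ℕ) :
    G.SubdivVertex m :=
  if i = 0 then Sum.inl (Quot.out e.1).1
  else if h : i - 1 < m - 1 then Sum.inr (e, ⟨i - 1, h⟩)
  else Sum.inl (Quot.out e.1).2

/-- The graph `G^{1/m}`, for `1 ≤ m`: every edge of `G` is replaced by a path with `m` edges. -/
noncomputable def subdivision {V : Type*} (G : SimpleGraph V) (m : ℕ) :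
    SimpleGraph (G.SubdivVertex m) :=
  SimpleGraph.fromRel fun x y =>
    ∃ e : G.edgeSet, ∃ i < m, x = G.subdivPath m e i ∧ y = G.subdivPath m e (i + 1)

/-- Adjacency of the power `G^k`: `u` and `v` are joined iff there is a walk of length `k` from
`u` to `v`; in particular there is a loop at `u` if there is a closed walk of length `k`
through `u`. -/
def powerAdj {V : Type*} (G : SimpleGraph V) (k : ℕ) (u v : V) : Prop :=
  ∃ w : G.Walk u v, w.length = k

/-- Adjacency of the fractional power `G^{k/m} = (G^{1/m})^k`. -/
def fracPowerAdj {V : Type*} (G : SimpleGraph V) (k m : ℕ) :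
    G.SubdivVertex m → G.SubdivVertex m → Prop :=
  (G.subdivision m).powerAdj k

end SimpleGraph

/-! Let T be the least t, as an infimum, such that the vertices can be placed on a circle of length
1 with adjacent ones within t of antipodal. Then χ_c = 1 / (1/2 - T) (`circularChromaticNumber_eq`),
so both formulas are linear statements about T. An odd subdivision divides T by 2s+1: the error of
an edge can be spread evenly along its path (`antipodalDefect_subdivision`). An odd power multiplies
T by 2r+1 as long as the result is below 1/4, that is, χ_c < 4 (`antipodalDefect_powerAdj`). One
inequality adds errors along walks. For the other, errors below 1/4 cannot wind around the circle,
so their sums along walks of length 2r+1 stay small, and a shortest-walk potential then evens them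
out over the edges. -/

/-- A relation is `t`-antipodally colorable if its vertices can be placed on the circle `ℝ / ℤ`
so that related vertices are within distance `t` of being antipodal. -/
def AntipodallyColorable {V : Type*} (A : V → V → Prop) (t : ℝ) : Prop :=
  ∃ c : V → ℝ, ∀ u v, A u v → ∃ k : ℤ, |c v - c u - 1 / 2 - k| ≤ t

/-- The infimum of all `t` for which a relation is `t`-antipodally colorable. -/
noncomputable def antipodalDefect {V : Type*} (A : V → V → Prop) : ℝ :=
  sInf {t : ℝ | 0 ≤ t ∧ AntipodallyColorable A t}

/-! ### Circular chromatic number and placements on a circle -/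

section Circular

variable {V : Type*} {A : V → V → Prop} {t t' : ℝ}

theorem AntipodallyColorable.mono (h : AntipodallyColorable A t) (ht : t ≤ t') :
    AntipodallyColorable A t' := by
  obtain ⟨c, hc⟩ := h
  refine ⟨c, fun u v huv => ?_⟩
  obtain ⟨k, hk⟩ := hc u v huv
  exact ⟨k, hk.trans ht⟩

theorem antipodallyColorable_half (A : V → V → Prop) : AntipodallyColorable A (1 / 2) :=
  ⟨fun _ => 0, fun _ _ _ => ⟨0, by norm_num [abs_of_nonneg]⟩⟩

theorem antipodalDefect_bddBelow (A : V → V → Prop) :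
    BddBelow {t : ℝ | 0 ≤ t ∧ AntipodallyColorable A t} :=
  ⟨0, fun _ h => h.1⟩

theorem antipodalDefect_nonempty (A : V → V → Prop) :
    {t : ℝ | 0 ≤ t ∧ AntipodallyColorable A t}.Nonempty :=
  ⟨1 / 2, by norm_num, antipodallyColorable_half A⟩

theorem antipodalDefect_nonneg (A : V → V → Prop) : 0 ≤ antipodalDefect A :=
  Real.sInf_nonneg fun _ h => h.1

theorem antipodalDefect_le (h0 : 0 ≤ t) (h : AntipodallyColorable A t) : antipodalDefect A ≤ t :=
  csInf_le (antipodalDefect_bddBelow A) ⟨h0, h⟩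

theorem exists_lt_of_antipodalDefect_lt (h : antipodalDefect A < t) :
    ∃ t', 0 ≤ t' ∧ AntipodallyColorable A t' ∧ t' < t := by
  obtain ⟨t', ⟨h0, h1⟩, h2⟩ := exists_lt_of_csInf_lt (antipodalDefect_nonempty A) h
  exact ⟨t', h0, h1, h2⟩

theorem antipodallyColorable_of_hom {n d : ℕ} (hd : 0 < d) (hn : 2 * d ≤ n)
    (φ : A →r circularCompleteAdj n d) : AntipodallyColorable A (1 / 2 - d / n) := by
  have hn0 : (0 : ℝ) < n := by
    have : 0 < n := by omega
    exact_mod_cast this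
  refine ⟨fun v => ((φ v : ℕ) : ℝ) / n, fun u v huv => ?_⟩
  obtain ⟨h1, h2⟩ := φ.map_rel huv
  have h1' : (d : ℝ) ≤ |((φ u : ℕ) : ℝ) - ((φ v : ℕ) : ℝ)| := by exact_mod_cast h1
  have h2' : |((φ u : ℕ) : ℝ) - ((φ v : ℕ) : ℝ)| ≤ n - d := by exact_mod_cast h2
  beta_reduce
  generalize ((φ u : ℕ) : ℝ) = x at *
  generalize ((φ v : ℕ) : ℝ) = y at *
  have key : ∀ k : ℤ, |y - x - n * (1 / 2 + k)| ≤ n * (1 / 2) - d →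
      |y / n - x / n - 1 / 2 - k| ≤ 1 / 2 - d / n := by
    intro k hk
    have e1 : y / n - x / n - 1 / 2 - k = (y - x - n * (1 / 2 + k)) / n := by
      field_simp
      ring
    have e2 : (1 : ℝ) / 2 - d / n = (n * (1 / 2) - d) / n := by field_simp
    rw [e1, e2, abs_div, abs_of_pos hn0]
    gcongr
  rcases le_total x y with h | h
  · rw [abs_of_nonpos (by linarith)] at h1' h2'
    refine ⟨0, key 0 ?_⟩
    rw [abs_le]
    push_cast
    constructor <;> linarith
  · rw [abs_of_nonneg (by linarith)] at h1' h2'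
    refine ⟨-1, key (-1) ?_⟩
    rw [abs_le]
    push_cast
    constructor <;> linarith

/-- Rounding down to multiples of 1/n loses nothing: it changes differences by less than 1/n, and
the bounds d and n - d are integers. -/
theorem AntipodallyColorable.nonempty_hom {n d : ℕ} (hd : 0 < d) (hn : 2 * d ≤ n)
    (h : AntipodallyColorable A (1 / 2 - d / n)) : Nonempty (A →r circularCompleteAdj n d) := by
  have hn0 : (0 : ℝ) < n := by
    have : 0 < n := by omega
    exact_mod_cast this
  have hd0 : (0 : ℝ) < d := by exact_mod_cast hd
  obtain ⟨c, hc⟩ := h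
  have hlt : ∀ v, ⌊(n : ℝ) * Int.fract (c v)⌋₊ < n := fun v => by
    rw [Nat.floor_lt (by have := Int.fract_nonneg (c v); positivity)]
    have := Int.fract_lt_one (c v)
    nlinarith
  refine ⟨⟨fun v => ⟨⌊(n : ℝ) * Int.fract (c v)⌋₊, hlt v⟩, fun {u v} huv => ?_⟩⟩
  obtain ⟨k, hk⟩ := hc u v huv
  have hu0 := Int.fract_nonneg (c u)
  have hv0 := Int.fract_nonneg (c v)
  have hu1 := Int.fract_lt_one (c u)
  have hv1 := Int.fract_lt_one (c v)
  have hu2 := Nat.floor_le (mul_nonneg hn0.le hu0)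
  have hv2 := Nat.floor_le (mul_nonneg hn0.le hv0)
  have hu3 := Nat.lt_floor_add_one ((n : ℝ) * Int.fract (c u))
  have hv3 := Nat.lt_floor_add_one ((n : ℝ) * Int.fract (c v))
  obtain ⟨k', hk'⟩ : ∃ k' : ℤ, c v - c u - 1 / 2 - k =
      Int.fract (c v) - Int.fract (c u) - 1 / 2 - k' := by
    refine ⟨k - ⌊c v⌋ + ⌊c u⌋, ?_⟩
    simp only [Int.fract]
    push_cast
    ring
  rw [hk'] at hk
  change (d : ℤ) ≤ |((⌊(n : ℝ) * Int.fract (c u)⌋₊ : ℕ) : ℤ) - (⌊(n : ℝ) * Int.fract (c v)⌋₊ : ℕ)| ∧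
    |((⌊(n : ℝ) * Int.fract (c u)⌋₊ : ℕ) : ℤ) - (⌊(n : ℝ) * Int.fract (c v)⌋₊ : ℕ)| ≤ (n : ℤ) - d
  generalize ⌊(n : ℝ) * Int.fract (c u)⌋₊ = i at *
  generalize ⌊(n : ℝ) * Int.fract (c v)⌋₊ = j at *
  generalize Int.fract (c u) = x at *
  generalize Int.fract (c v) = y at *
  have hdn : (0 : ℝ) < d / n := by positivity
  obtain ⟨hk1, hk2⟩ := abs_le.1 hk
  -- Fractional parts differ by less than 1, which leaves two cases: which of x, y is the larger.
  have hk3 : k' < 1 := by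
    have : (k' : ℝ) < 1 := by linarith
    exact_mod_cast this
  have hk4 : -2 < k' := by
    have : (-2 : ℝ) < k' := by linarith
    exact_mod_cast this
  have e : (d : ℝ) = n * (d / n) := by field_simp
  obtain rfl | rfl : k' = 0 ∨ k' = -1 := by omega
  · push_cast at hk1 hk2
    have a1 : (d : ℝ) ≤ n * y - n * x := by
      rw [e, ← mul_sub]; gcongr; linarith
    have a2 : n * y - n * x ≤ (n : ℝ) - d := by
      have : (n : ℝ) - d = n * (1 - d / n) := by rw [mul_sub, ← e]; ring
      rw [this, ← mul_sub]; exact mul_le_mul_of_nonneg_left (by linarith) hn0.le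
    have b1 : (d : ℤ) < j - i + 1 := by
      have : (d : ℝ) < j - i + 1 := by linarith
      exact_mod_cast this
    have b2 : (j : ℤ) - i < n - d + 1 := by
      have : (j : ℝ) - i < n - d + 1 := by linarith
      exact_mod_cast this
    rw [abs_of_nonpos (by omega)]
    omega
  · push_cast at hk1 hk2
    have a1 : (d : ℝ) ≤ n * x - n * y := by
      rw [e, ← mul_sub]; gcongr; linarith
    have a2 : n * x - n * y ≤ (n : ℝ) - d := by
      have : (n : ℝ) - d = n * (1 - d / n) := by rw [mul_sub, ← e]; ring
      rw [this, ← mul_sub]; exact mul_le_mul_of_nonneg_left (by linarith) hn0.le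
    have b1 : (d : ℤ) < i - j + 1 := by
      have : (d : ℝ) < i - j + 1 := by linarith
      exact_mod_cast this
    have b2 : (i : ℤ) - j < n - d + 1 := by
      have : (i : ℝ) - j < n - d + 1 := by linarith
      exact_mod_cast this
    rw [abs_of_nonneg (by omega)]
    omega

theorem antipodalDefect_le_of_hom {n d : ℕ} (hd : 0 < d) (hn : 2 * d ≤ n)
    (φ : A →r circularCompleteAdj n d) : antipodalDefect A ≤ 1 / 2 - d / n := by
  refine antipodalDefect_le ?_ (antipodallyColorable_of_hom hd hn φ)
  have hn0 : (0 : ℝ) < n := by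
    have : 0 < n := by omega
    exact_mod_cast this
  have : (2 : ℝ) * d ≤ n := by exact_mod_cast hn
  rw [sub_nonneg, div_le_iff₀ hn0]
  linarith

theorem circularChromaticNumber_eq (h : antipodalDefect A < 1 / 2) :
    circularChromaticNumber A = ((1 / (1 / 2 - antipodalDefect A) : ℝ) : EReal) := by
  have hT := antipodalDefect_nonneg A
  apply le_antisymm
  · rw [← EReal.le_of_forall_lt_iff_le]
    intro y hy
    rw [EReal.coe_lt_coe_iff] at hy
    -- Any rational q above 1 / (1/2 - T) exceeds 2, so its numerator and denominator give an
    -- admissible target.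
    obtain ⟨q, hq1, hq2⟩ := exists_rat_btwn hy
    have hpos : 0 < 1 / 2 - antipodalDefect A := by linarith
    have h2 : 2 ≤ 1 / (1 / 2 - antipodalDefect A) := by
      rw [le_div_iff₀ hpos]; linarith
    have hq2' : (2 : ℝ) < q := h2.trans_lt hq1
    have hqn : (q.num.toNat : ℤ) = q.num := by
      apply Int.toNat_of_nonneg
      rw [Rat.num_nonneg]
      have : (0 : ℝ) ≤ q := by linarith
      exact_mod_cast this
    have hd : 0 < q.den := q.den_pos
    have hd' : (0 : ℝ) < q.den := by exact_mod_cast hd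
    have hqe : (q.num.toNat : ℝ) / (q.den : ℝ) = q := by
      rw [Rat.cast_def q]
      congr 1
      exact_mod_cast hqn
    have hn : 2 * q.den ≤ q.num.toNat := by
      have : (2 : ℝ) * q.den ≤ q.num.toNat := by
        rw [← le_div_iff₀ hd', hqe]; exact hq2'.le
      exact_mod_cast this
    obtain ⟨t, -, ht1, ht2⟩ : ∃ t', 0 ≤ t' ∧ AntipodallyColorable A t' ∧
        t' < 1 / 2 - (q.den : ℝ) / q.num.toNat := by
      apply exists_lt_of_antipodalDefect_lt
      rw [← inv_div (q.num.toNat : ℝ), hqe, ← one_div]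
      have := one_div_lt_one_div_of_lt (by positivity) hq1
      rw [one_div_one_div] at this
      linarith
    have hmem : circularChromaticNumber A ≤ (((q.num.toNat : ℝ) / (q.den : ℝ) : ℝ) : EReal) :=
      sInf_le ⟨q.num.toNat, q.den, hd, hn, (ht1.mono ht2.le).nonempty_hom hd hn, rfl⟩
    refine hmem.trans ?_
    rw [hqe, EReal.coe_le_coe_iff]
    exact hq2.le
  · refine le_sInf ?_
    rintro x ⟨n, d, hd, hn, ⟨φ⟩, rfl⟩
    rw [EReal.coe_le_coe_iff]
    have := antipodalDefect_le_of_hom hd hn φ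
    have hn0 : (0 : ℝ) < n := by
      have : 0 < n := by omega
      exact_mod_cast this
    have hd0 : (0 : ℝ) < d := by exact_mod_cast hd
    rw [← one_div_div (d : ℝ) n]
    exact one_div_le_one_div_of_le (by positivity) (by linarith)

theorem antipodalDefect_lt_of_circularChromaticNumber_lt {x : ℝ}
    (h : circularChromaticNumber A < x) : antipodalDefect A < 1 / 2 - 1 / x := by
  obtain ⟨_, ⟨n, d, hd, hn, ⟨φ⟩, rfl⟩, hx⟩ := sInf_lt_iff.1 h
  rw [EReal.coe_lt_coe_iff] at hx
  have hn0 : (0 : ℝ) < n := by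
    have : 0 < n := by omega
    exact_mod_cast this
  have hd0 : (0 : ℝ) < d := by exact_mod_cast hd
  have := one_div_lt_one_div_of_lt (by positivity) hx
  rw [one_div_div] at this
  linarith [antipodalDefect_le_of_hom hd hn φ]

end Circular

namespace SimpleGraph

variable {V : Type*} {G : SimpleGraph V} {t : ℝ}

theorem antipodalDefect_adj_lt_half [Finite V] (G : SimpleGraph V) :
    antipodalDefect G.Adj < 1 / 2 := by
  obtain ⟨n, ⟨e⟩⟩ := Finite.exists_equiv_fin V
  -- n + 2 rather than n keeps 2 * d ≤ n valid for d = 1 when there are fewer than two vertices.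
  have φ : G.Adj →r circularCompleteAdj (n + 2) 1 :=
    ⟨fun v => Fin.castLE (by omega) (e v), fun {u v} huv => by
      have hne : ((e u : ℕ) : ℤ) ≠ (e v : ℕ) := by
        have : e u ≠ e v := fun h => huv.ne (e.injective h)
        exact fun h => this (Fin.ext (by exact_mod_cast h))
      have hu := (e u).isLt
      have hv := (e v).isLt
      change ((1 : ℕ) : ℤ) ≤ |((e u : ℕ) : ℤ) - (e v : ℕ)| ∧
        |((e u : ℕ) : ℤ) - (e v : ℕ)| ≤ ((n + 2 : ℕ) : ℤ) - ((1 : ℕ) : ℤ)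
      push_cast
      rcases abs_cases (((e u : ℕ) : ℤ) - (e v : ℕ)) with h | h <;> omega⟩
  have := antipodalDefect_le_of_hom one_pos (by omega) φ
  have : (0 : ℝ) < (1 : ℕ) / (n + 2 : ℕ) := by positivity
  linarith

/-! ### Odd powers -/

theorem exists_abs_sub_le_of_walk {c : V → ℝ}
    (hc : ∀ u v, G.Adj u v → ∃ k : ℤ, |c v - c u - 1 / 2 - k| ≤ t) {u v : V} (p : G.Walk u v) :
    ∃ k : ℤ, |c v - c u - p.length / 2 - k| ≤ p.length * t := by
  induction p with
  | nil => exact ⟨0, by simp⟩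
  | @cons u w v h p ih =>
    obtain ⟨k, hk⟩ := ih
    obtain ⟨l, hl⟩ := hc _ _ h
    refine ⟨k + l, ?_⟩
    rw [abs_le] at *
    push_cast [Walk.length_cons]
    constructor <;> linarith

theorem antipodallyColorable_powerAdj (r : ℕ) (h : AntipodallyColorable G.Adj t) :
    AntipodallyColorable (G.powerAdj (2 * r + 1)) ((2 * r + 1) * t) := by
  obtain ⟨c, hc⟩ := h
  refine ⟨c, ?_⟩
  rintro u v ⟨p, hp⟩
  obtain ⟨k, hk⟩ := exists_abs_sub_le_of_walk hc p
  refine ⟨k + r, ?_⟩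
  rw [hp] at hk
  push_cast at hk ⊢
  convert hk using 2
  ring

/-- The first edge can be traversed back and forth. -/
theorem exists_walk_length_odd_of_le {i j : ℕ} (hij : i ≤ j) {u v : V} (p : G.Walk u v)
    (hp : p.length = 2 * i + 1) : ∃ q : G.Walk u v, q.length = 2 * j + 1 := by
  induction j, hij using Nat.le_induction with
  | base => exact ⟨p, hp⟩
  | succ j _ ih =>
    obtain ⟨q, hq⟩ := ih
    cases q with
    | nil => simp at hq
    | cons h q =>
      refine ⟨.cons h (.cons h.symm (.cons h q)), ?_⟩
      simp only [Walk.length_cons] at hq ⊢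
      omega

/-- The sum of the values of `δ` on the consecutive pairs of vertices of a walk. -/
def Walk.pairSum (δ : V → V → ℝ) {u v : V} : G.Walk u v → ℝ
  | .nil => 0
  | .cons (u := u) (v := w) _ p => δ u w + Walk.pairSum δ p

theorem Walk.pairSum_sub_mem_int {c : V → ℝ} {δ : V → V → ℝ}
    (hδ : ∀ u v, ∃ k : ℤ, δ u v = c v - c u - 1 / 2 - k) {u v : V} (p : G.Walk u v) :
    ∃ k : ℤ, p.pairSum δ = c v - c u - p.length / 2 - k := by
  induction p with
  | nil => exact ⟨0, by simp [pairSum]⟩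
  | @cons u w v h p ih =>
    obtain ⟨k, hk⟩ := ih
    obtain ⟨l, hl⟩ := hδ u w
    refine ⟨k + l, ?_⟩
    push_cast [Walk.length_cons, pairSum]
    rw [hk, hl]
    ring

/-- If all odd walks up to a given length end within `t < 1 / 4` of the antipode of their start,
then the steps of such a walk add up without winding around the circle. -/
theorem Walk.abs_pairSum_le {c : V → ℝ} {δ : V → V → ℝ} {r : ℕ} (ht : t < 1 / 4)
    (hδ : ∀ u v, ∃ k : ℤ, δ u v = c v - c u - 1 / 2 - k)
    (hδt : ∀ u v, G.Adj u v → |δ u v| ≤ t)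
    (hc : ∀ u v, G.powerAdj (2 * r + 1) u v → ∃ k : ℤ, |c v - c u - 1 / 2 - k| ≤ t)
    {j : ℕ} (hj : j ≤ r) {u v : V} (p : G.Walk u v) (hp : p.length = 2 * j + 1) :
    |p.pairSum δ| ≤ t := by
  induction j generalizing u v with
  | zero =>
    match p, hp with
    | .cons h .nil, _ => simpa [pairSum] using hδt _ _ h
  | succ j ih =>
    obtain ⟨k, hk⟩ := hc u v (exists_walk_length_odd_of_le hj p hp)
    obtain ⟨l, hl⟩ := p.pairSum_sub_mem_int hδ
    rw [hp] at hl
    -- Two edges and the inductive bound: at most 3t.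
    have hs : |p.pairSum δ| < 3 / 4 := by
      match p, hp with
      | .cons h (.cons h' q), hp =>
        have h1 := abs_le.1 (hδt _ _ h)
        have h2 := abs_le.1 (hδt _ _ h')
        have h3 := abs_le.1 (ih (by omega) q (by simp only [Walk.length_cons] at hp; omega))
        simp only [pairSum]
        rw [abs_lt]
        constructor <;> linarith
    have e : c v - c u - 1 / 2 - k = p.pairSum δ + ((j + 1 + l - k : ℤ) : ℝ) := by
      rw [hl]; push_cast; ring
    rw [e] at hk
    -- An integer of absolute value below 3/4 + 1/4 vanishes.
    have hz : j + 1 + l - k = 0 := by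
      obtain ⟨h1, h2⟩ := abs_le.1 hk
      obtain ⟨h3, h4⟩ := abs_lt.1 hs
      have h5 : ((j + 1 + l - k : ℤ) : ℝ) < 1 := by linarith
      have h6 : (-1 : ℝ) < ((j + 1 + l - k : ℤ) : ℝ) := by linarith
      have h5' : (j + 1 + l - k : ℤ) < 1 := by exact_mod_cast h5
      have h6' : -1 < (j + 1 + l - k : ℤ) := by exact_mod_cast h6
      omega
    rwa [hz, Int.cast_zero, add_zero] at hk

/-- If every walk of length `n + 1` has nonnegative total weight, where each edge carries the
weight `a + δ`, then the edge weights admit a potential. -/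
theorem exists_potential {δ : V → V → ℝ} {a b : ℝ} {n : ℕ} (ha : 0 ≤ a)
    (hb : ∀ u v, G.Adj u v → |δ u v| ≤ b)
    (h : ∀ u v (p : G.Walk u v), p.length = n + 1 → 0 ≤ (n + 1) * a + p.pairSum δ) :
    ∃ f : V → ℝ, ∀ u v, G.Adj u v → f u ≤ a + δ u v + f v := by
  let S : V → Set ℝ := fun u =>
    {x | ∃ v, ∃ p : G.Walk u v, p.length ≤ n ∧ x = p.length * a + p.pairSum δ}
  have hlow : ∀ u v (p : G.Walk u v), -(p.length * |b|) ≤ p.pairSum δ := by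
    intro u v p
    induction p with
    | nil => simp [Walk.pairSum]
    | cons h p ih =>
      have := (abs_le.1 (hb _ _ h)).1
      have := le_abs_self b
      push_cast [Walk.length_cons, Walk.pairSum]
      linarith
  have hbdd : ∀ u, BddBelow (S u) := by
    refine fun u => ⟨-(n * |b|), ?_⟩
    rintro _ ⟨v, p, hp, rfl⟩
    have h1 := hlow u v p
    have h2 : (p.length : ℝ) * |b| ≤ n * |b| := by gcongr
    have h3 : 0 ≤ (p.length : ℝ) * a := by positivity
    linarith
  have hnil : ∀ u, (0 : ℝ) ∈ S u := fun u => ⟨u, .nil, by simp, by simp [Walk.pairSum]⟩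
  -- The potential is the least weight of a walk from u with at most n edges.
  refine ⟨fun u => sInf (S u), fun u v huv => ?_⟩
  rw [← sub_le_iff_le_add']
  refine le_csInf ⟨0, hnil v⟩ ?_
  rintro _ ⟨w, p, hp, rfl⟩
  rw [sub_le_iff_le_add']
  have e : a + δ u v + (p.length * a + p.pairSum δ) =
      (Walk.cons huv p).length * a + (Walk.cons huv p).pairSum δ := by
    push_cast [Walk.length_cons, Walk.pairSum]
    ring
  rw [e]
  rcases hp.lt_or_eq with hp | hp
  · exact csInf_le (hbdd u) ⟨w, _, by simpa using hp, rfl⟩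
  -- The extended walk is too long for S u, but its weight is nonnegative, so the empty walk does as
  -- well.
  · refine (csInf_le (hbdd u) (hnil u)).trans ?_
    have := h _ _ (Walk.cons huv p) (by simp [hp])
    push_cast [Walk.length_cons, hp] at this ⊢
    exact this

/-- The errors δ sum to at least -t along walks of length 2r+1, so the weights t/(2r+1) + δ have a
potential f. Shifting c by f bounds the new error from one side; antisymmetry of δ gives the other.
-/
theorem antipodallyColorable_of_powerAdj {r : ℕ} (h0 : 0 ≤ t) (ht : t < 1 / 4)
    (h : AntipodallyColorable (G.powerAdj (2 * r + 1)) t) :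
    AntipodallyColorable G.Adj (t / (2 * r + 1)) := by
  obtain ⟨c, hc⟩ := h
  let δ : V → V → ℝ := fun u v => c v - c u - 1 / 2 - round (c v - c u - 1 / 2)
  have hδ : ∀ u v, ∃ k : ℤ, δ u v = c v - c u - 1 / 2 - k := fun u v => ⟨_, rfl⟩
  have hδt : ∀ u v, G.Adj u v → |δ u v| ≤ t := by
    intro u v huv
    obtain ⟨k, hk⟩ := hc u v (exists_walk_length_odd_of_le (Nat.zero_le r) (Walk.cons huv .nil) rfl)
    exact (round_le _ k).trans hk
  have hanti : ∀ u v, G.Adj u v → δ v u = -δ u v := by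
    intro u v huv
    obtain ⟨k, hk⟩ := hδ u v
    obtain ⟨l, hl⟩ := hδ v u
    obtain ⟨h1, h2⟩ := abs_le.1 (hδt u v huv)
    obtain ⟨h3, h4⟩ := abs_le.1 (hδt v u huv.symm)
    have e : δ u v + δ v u = ((-1 - k - l : ℤ) : ℝ) := by
      rw [hk, hl]; push_cast; ring
    have h5 : ((-1 - k - l : ℤ) : ℝ) < 1 := by linarith
    have h6 : (-1 : ℝ) < ((-1 - k - l : ℤ) : ℝ) := by linarith
    have h5' : (-1 - k - l : ℤ) < 1 := by exact_mod_cast h5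
    have h6' : -1 < (-1 - k - l : ℤ) := by exact_mod_cast h6
    have hz : -1 - k - l = 0 := by omega
    rw [hz, Int.cast_zero] at e
    linarith
  obtain ⟨f, hf⟩ := exists_potential (a := t / (2 * r + 1)) (n := 2 * r) (by positivity) hδt
    (fun u v p hp => by
      have := (abs_le.1 (p.abs_pairSum_le ht hδ hδt hc le_rfl hp)).1
      push_cast
      rw [mul_div_cancel₀ _ (by positivity)]
      linarith)
  refine ⟨fun v => c v + f v, fun u v huv => ⟨round (c v - c u - 1 / 2), ?_⟩⟩
  have h1 := hf u v huv
  have h2 := hf v u huv.symm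
  rw [hanti u v huv] at h2
  have e : c v + f v - (c u + f u) - 1 / 2 - round (c v - c u - 1 / 2) = δ u v + f v - f u := by
    simp only [δ]; ring
  rw [e, abs_le]
  constructor <;> linarith

theorem antipodalDefect_powerAdj_le (G : SimpleGraph V) (r : ℕ) :
    antipodalDefect (G.powerAdj (2 * r + 1)) ≤ (2 * r + 1) * antipodalDefect G.Adj := by
  rw [← div_le_iff₀' (by positivity)]
  refine le_csInf (antipodalDefect_nonempty _) ?_
  rintro t ⟨h0, h⟩
  rw [div_le_iff₀' (by positivity)]
  exact antipodalDefect_le (by positivity) (antipodallyColorable_powerAdj r h)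

theorem antipodalDefect_powerAdj (G : SimpleGraph V) (r : ℕ)
    (h : antipodalDefect (G.powerAdj (2 * r + 1)) < 1 / 4) :
    antipodalDefect (G.powerAdj (2 * r + 1)) = (2 * r + 1) * antipodalDefect G.Adj := by
  refine le_antisymm (antipodalDefect_powerAdj_le G r) (le_of_forall_gt fun y hy => ?_)
  obtain ⟨t, h0, h1, h2⟩ := exists_lt_of_antipodalDefect_lt (lt_min h hy)
  have := antipodalDefect_le (by positivity)
    (antipodallyColorable_of_powerAdj h0 (h2.trans_le (min_le_left _ _)) h1)
  rw [le_div_iff₀' (by positivity)] at this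
  exact this.trans_lt (h2.trans_le (min_le_right _ _))

/-! ### Odd subdivisions -/

theorem out_adj (e : G.edgeSet) : G.Adj (Quot.out e.1).1 (Quot.out e.1).2 := by
  have h : s((Quot.out e.1).1, (Quot.out e.1).2) = e.1 := Quot.out_eq e.1
  rw [← mem_edgeSet, h]
  exact e.2

theorem subdivPath_zero (m : ℕ) (e : G.edgeSet) :
    G.subdivPath m e 0 = Sum.inl (Quot.out e.1).1 := by
  simp [subdivPath]

theorem subdivPath_self {m : ℕ} (hm : 0 < m) (e : G.edgeSet) :
    G.subdivPath m e m = Sum.inl (Quot.out e.1).2 := by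
  simp [subdivPath, hm.ne']

theorem subdivPath_inner {m i : ℕ} (h0 : 0 < i) (h : i - 1 < m - 1) (e : G.edgeSet) :
    G.subdivPath m e i = Sum.inr (e, ⟨i - 1, h⟩) := by
  simp [subdivPath, h0.ne', h]

theorem subdivPath_adj {m i : ℕ} (hi : i < m) (e : G.edgeSet) :
    (G.subdivision m).Adj (G.subdivPath m e i) (G.subdivPath m e (i + 1)) := by
  refine ⟨?_, Or.inl ⟨e, i, hi, rfl, rfl⟩⟩
  have hne := (out_adj e).ne
  rcases Nat.eq_zero_or_pos i with rfl | h0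
  · rcases (Nat.succ_le_of_lt hi).eq_or_lt with h | h
    · subst h
      rw [subdivPath_zero, zero_add, Nat.succ_eq_add_one, zero_add, subdivPath_self one_pos]
      simpa using hne
    · rw [subdivPath_zero, subdivPath_inner (by omega) (by omega)]
      simp
  · rw [subdivPath_inner h0 (by omega)]
    rcases (Nat.succ_le_of_lt hi).eq_or_lt with h | h
    · subst h
      rw [subdivPath_self (by omega)]
      simp
    · rw [subdivPath_inner (by omega) (by omega)]
      simp only [ne_eq, Sum.inr.injEq, Prod.mk.injEq, Fin.mk.injEq, true_and]
      omega

theorem exists_walk_subdivPath {m i : ℕ} (hi : i ≤ m) (e : G.edgeSet) :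
    ∃ p : (G.subdivision m).Walk (G.subdivPath m e 0) (G.subdivPath m e i), p.length = i := by
  induction i with
  | zero => exact ⟨.nil, rfl⟩
  | succ i ih =>
    obtain ⟨p, hp⟩ := ih (by omega)
    exact ⟨p.concat (subdivPath_adj (by omega) e), by simp [hp]⟩

theorem powerAdj_subdivision_of_adj {m : ℕ} (hm : 0 < m) {u v : V} (h : G.Adj u v) :
    (G.subdivision m).powerAdj m (Sum.inl u) (Sum.inl v) := by
  obtain ⟨p, hp⟩ := exists_walk_subdivPath (le_refl m) (⟨s(u, v), h⟩ : G.edgeSet)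
  have hout : s((Quot.out s(u, v)).1, (Quot.out s(u, v)).2) = s(u, v) := Quot.out_eq s(u, v)
  rw [Sym2.eq_iff] at hout
  rw [powerAdj]
  -- The chosen direction of the edge may be opposite to u, v.
  rcases hout with ⟨h1, h2⟩ | ⟨h1, h2⟩
  · refine ⟨p.copy ?_ ?_, (p.length_copy _ _).trans hp⟩
    · rw [subdivPath_zero, h1]
    · rw [subdivPath_self hm, h2]
  · refine ⟨p.reverse.copy ?_ ?_, (p.reverse.length_copy _ _).trans (p.length_reverse.trans hp)⟩
    · rw [subdivPath_self hm, h2]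
    · rw [subdivPath_zero, h1]

theorem antipodallyColorable_of_subdivision (s : ℕ)
    (h : AntipodallyColorable (G.subdivision (2 * s + 1)).Adj t) :
    AntipodallyColorable G.Adj ((2 * s + 1) * t) := by
  obtain ⟨c, hc⟩ := antipodallyColorable_powerAdj s h
  exact ⟨fun v => c (Sum.inl v), fun u v huv =>
    hc _ _ (powerAdj_subdivision_of_adj (by omega) huv)⟩

theorem antipodallyColorable_subdivision (s : ℕ) (h : AntipodallyColorable G.Adj t) :
    AntipodallyColorable (G.subdivision (2 * s + 1)).Adj (t / (2 * s + 1)) := by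
  obtain ⟨c, hc⟩ := h
  choose k hk using fun e : G.edgeSet => hc _ _ (out_adj e)
  have hm : (0 : ℝ) < 2 * s + 1 := by positivity
  let ε : G.edgeSet → ℝ := fun e =>
    (c (Quot.out e.1).2 - c (Quot.out e.1).1 - 1 / 2 - k e) / (2 * s + 1)
  have hε : ∀ e, |ε e| ≤ t / (2 * s + 1) := fun e => by
    rw [abs_div, abs_of_pos hm]
    gcongr
    exact hk e
  -- Inner vertex i sits at position i + 1 of its path; each step is a half turn plus ε.
  let c' : G.SubdivVertex (2 * s + 1) → ℝ := Sum.elim c fun x =>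
    c (Quot.out x.1.1).1 + (x.2 + 1) * (1 / 2 + ε x.1)
  have hc' : ∀ e i, i ≤ 2 * s + 1 → ∃ l : ℤ, c' (G.subdivPath (2 * s + 1) e i) =
      c (Quot.out e.1).1 + i * (1 / 2 + ε e) + l := by
    intro e i hi
    rcases Nat.eq_zero_or_pos i with rfl | h0
    · exact ⟨0, by simp [subdivPath_zero, c']⟩
    rcases hi.eq_or_lt with rfl | hi
    -- At the far end, 2s+1 half turns make s full turns and a half.
    · refine ⟨k e - s, ?_⟩
      rw [subdivPath_self (by omega)]
      simp only [c', ε, Sum.elim_inl]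
      push_cast
      field_simp
      ring
    · refine ⟨0, ?_⟩
      rw [subdivPath_inner h0 (by omega)]
      obtain ⟨i, rfl⟩ := Nat.exists_eq_succ_of_ne_zero h0.ne'
      simp [c']
  have key : ∀ e i, i < 2 * s + 1 → ∃ l : ℤ, c' (G.subdivPath (2 * s + 1) e (i + 1)) -
      c' (G.subdivPath (2 * s + 1) e i) - 1 / 2 - l = ε e := by
    intro e i hi
    obtain ⟨l₁, h₁⟩ := hc' e i hi.le
    obtain ⟨l₂, h₂⟩ := hc' e (i + 1) hi
    refine ⟨l₂ - l₁, ?_⟩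
    rw [h₁, h₂]
    push_cast
    ring
  refine ⟨c', ?_⟩
  rintro x y ⟨-, ⟨e, i, hi, rfl, rfl⟩ | ⟨e, i, hi, rfl, rfl⟩⟩
  · obtain ⟨l, hl⟩ := key e i hi
    exact ⟨l, by rw [hl]; exact hε e⟩
  · obtain ⟨l, hl⟩ := key e i hi
    refine ⟨-1 - l, ?_⟩
    rw [← abs_neg]
    convert hε e using 2
    rw [← hl]
    push_cast
    ring

theorem antipodalDefect_subdivision (G : SimpleGraph V) (s : ℕ) :
    antipodalDefect (G.subdivision (2 * s + 1)).Adj = antipodalDefect G.Adj / (2 * s + 1) := by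
  apply le_antisymm
  · rw [le_div_iff₀' (by positivity)]
    refine le_csInf (antipodalDefect_nonempty _) ?_
    rintro t ⟨h0, h⟩
    rw [← le_div_iff₀' (by positivity)]
    exact antipodalDefect_le (by positivity) (antipodallyColorable_subdivision s h)
  · refine le_csInf (antipodalDefect_nonempty _) ?_
    rintro t ⟨h0, h⟩
    rw [div_le_iff₀' (by positivity)]
    exact antipodalDefect_le (by positivity) (antipodallyColorable_of_subdivision s h)

end SimpleGraph

/-! ### The formulas for χ_c -/

theorem mainTheorem1 {V : Type*} [Finite V] (G : SimpleGraph V) (hG : ¬ G.IsBipartite)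
    (r s : ℕ) :
    ∃ χ : ℝ, circularChromaticNumber G.Adj = (χ : EReal) ∧
      circularChromaticNumber (G.subdivision (2 * s + 1)).Adj =
        (((2 * (s : ℝ) + 1) * χ / ((s : ℝ) * χ + 1) : ℝ) : EReal) ∧
      (circularChromaticNumber (G.fracPowerAdj (2 * r + 1) (2 * s + 1)) < 4 →
        0 < ((s : ℝ) - (r : ℝ)) * χ + 2 * (r : ℝ) + 1 ∧
        circularChromaticNumber (G.fracPowerAdj (2 * r + 1) (2 * s + 1)) =
          (((2 * (s : ℝ) + 1) * χ / (((s : ℝ) - (r : ℝ)) * χ + 2 * (r : ℝ) + 1) : ℝ) : EReal)) := by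
  have hT := G.antipodalDefect_adj_lt_half
  have hS := G.antipodalDefect_subdivision s
  have hs : (0 : ℝ) < 2 * s + 1 := by positivity
  refine ⟨_, circularChromaticNumber_eq hT, ?_, fun h4 => ?_⟩
  · have hlt : antipodalDefect (G.subdivision (2 * s + 1)).Adj < 1 / 2 := by
      rw [hS, div_lt_iff₀ hs]
      have : (0 : ℝ) ≤ s := s.cast_nonneg
      linarith
    rw [circularChromaticNumber_eq hlt, EReal.coe_eq_coe_iff]
    rw [hS] at hlt ⊢
    generalize antipodalDefect G.Adj = T at *
    have h1 : 1 / 2 - T ≠ 0 := by linarith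
    have h2 : 1 / 2 - T / (2 * s + 1) ≠ 0 := by linarith
    have h3 : (s : ℝ) * (1 / (1 / 2 - T)) + 1 =
        (2 * s + 1) * (1 / 2 - T / (2 * s + 1)) / (1 / 2 - T) := by
      rw [mul_sub, mul_div_cancel₀ _ hs.ne', eq_div_iff h1, add_mul, mul_assoc,
        one_div_mul_cancel h1]
      ring
    rw [h3]
    generalize 1 / 2 - T / (2 * s + 1) = D at *
    generalize 1 / 2 - T = E at *
    field_simp
  · have hlt : antipodalDefect (G.fracPowerAdj (2 * r + 1) (2 * s + 1)) < 1 / 4 := by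
      have := antipodalDefect_lt_of_circularChromaticNumber_lt (x := 4) h4
      linarith
    have hP : antipodalDefect (G.fracPowerAdj (2 * r + 1) (2 * s + 1)) = _ :=
      (G.subdivision (2 * s + 1)).antipodalDefect_powerAdj r hlt
    rw [circularChromaticNumber_eq (by linarith), EReal.coe_eq_coe_iff]
    rw [hP, hS] at hlt ⊢
    generalize antipodalDefect G.Adj = T at *
    have h1 : 0 < 1 / 2 - T := by linarith
    have h2 : 0 < 1 / 2 - (2 * r + 1) * (T / (2 * s + 1)) := by linarith
    -- The denominator is a positive multiple of the quotient of the two gaps 1/2 - T, of the power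
    -- and of G.
    have h3 : ((s : ℝ) - r) * (1 / (1 / 2 - T)) + 2 * r + 1 =
        (2 * s + 1) * (1 / 2 - (2 * r + 1) * (T / (2 * s + 1))) / (1 / 2 - T) := by
      have e : (2 * (s : ℝ) + 1) * (1 / 2 - (2 * r + 1) * (T / (2 * s + 1))) =
          s + 1 / 2 - (2 * r + 1) * T := by
        field_simp
      rw [e, eq_div_iff h1.ne', add_mul, add_mul, mul_assoc, one_div_mul_cancel h1.ne']
      ring
    rw [h3]
    refine ⟨by positivity, ?_⟩
    have h2' := h2.ne'
    generalize 1 / 2 - (2 * r + 1) * (T / (2 * s + 1)) = D at *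
    have h1' := h1.ne'
    generalize 1 / 2 - T = E at *
    field_simp
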